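/- Theorem 2. For an integer $r\ge 1$ and flip parameters $\mathbf a=(a_i)$, sums $\sum_{i=\frac{r+1}{2}}^{r}$ being taken over all integers $i$ with $\frac{r+1}{2}\le i\le r$, let $$R_{r,\mathbf a}(p)=\sum_{i=\frac{r+1}{2}}^{r}\binom{r}{i}\left[(1-a_i)\,p^{i}(1-p)^{r-i}+a_i\,p^{r-i}(1-p)^{i}\right],\qquad p\in\mathbb{R},$$ and let $$\lambda_r(\mathbf a):=R_{r,\mathbf a}'(1/2)=\frac{1}{2^{r-1}}\sum_{i=\frac{r+1}{2}}^{r}\binom{r}{i}(2i-r)(1-2a_i).$$ Let $(a_i)_{i\in\mathbb{N}}$ be a sequence of independent and identically distributed random variables with values almost surely in $[0,1]$, with $\mathbb{E}a_i=1/2$ for each $i$ and $\operatorname{Var}a_1>0$. Define $$b_{ri}:=\binom{r}{i}\frac{2i-r}{2^{r-1}}\quad\text{for integers } \tfrac{r+1}{2}\le i\le r,\qquad s_r:=\sqrt{\sum_{i=\frac{r+1}{2}}^{r}b_{ri}^2}.$$ Then, as $r\to\infty$: 1. $s_r=\Theta(r^{1/4})$; 2. $\lambda_r(\mathbf a)/s_r$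 converges in distribution to the normal distribution $\mathcal N(0,4\operatorname{Var}a_1)$ with mean $0$ and variance $4\operatorname{Var}a_1$; 3. $\operatorname{Var}\lambda_r(\mathbf a)=\Theta(\sqrt r)$. Here $x_r=\Theta(y_r)$ means $\liminf_{r\to\infty}|x_r/y_r|>0$ and $\limsup_{r\to\infty}|x_r/y_r|<\infty$. -/

import Mathlib

open MeasureTheory ProbabilityTheory Filter Asymptotics

noncomputable section

namespace LocalFlip

/-- The possible sizes of a majority in a group of size `r`: the integers `i` with
`(r + 1) / 2 ≤ i ≤ r` (the condition is stated without division). -/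
def majoritySizes (r : ℕ) : Finset ℕ :=
  {i ∈ Finset.range (r + 1) | r + 1 ≤ 2 * i}

/-- The update function `R_{r,a}(p)` of the local flip model with group size `r` and flip
parameters `a`. Only the values `a i` with `i ∈ majoritySizes r` are used. -/
def updateFunction (r : ℕ) (a : ℕ → ℝ) (p : ℝ) : ℝ :=
  ∑ i ∈ majoritySizes r, (r.choose i : ℝ) *
    ((1 - a i) * (p ^ i * (1 - p) ^ (r - i)) + a i * (p ^ (r - i) * (1 - p) ^ i))

/-- The stability parameter `λ_r(a) = R'_{r,a}(1/2)` of the fixed point `1/2`. -/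
def stabilityParameter (r : ℕ) (a : ℕ → ℝ) : ℝ :=
  deriv (updateFunction r a) (1 / 2)

/-- The constants `b_{ri} = (r choose i) (2i - r) / 2^(r-1)`. They are used only for
`i ∈ majoritySizes r`, so that `r ≥ 1` and the exponent is not truncated. -/
def coeff (r i : ℕ) : ℝ :=
  (r.choose i : ℝ) * ((2 * (i : ℝ) - (r : ℝ)) / 2 ^ (r - 1))

/-- The normalisation `s_r = √(∑ b_{ri}²)`. -/
def scale (r : ℕ) : ℝ :=
  √(∑ i ∈ majoritySizes r, coeff r i ^ 2)

theorem hasDerivAt_updateFunction (r : ℕ) (a : ℕ → ℝ) :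
    HasDerivAt (updateFunction r a)
      (∑ i ∈ majoritySizes r, coeff r i * (1 - 2 * a i)) (1 / 2) := by
  unfold updateFunction
  refine HasDerivAt.fun_sum fun i hi => ?_
  obtain ⟨hi1, hi2⟩ := Finset.mem_filter.1 hi
  obtain ⟨j, rfl⟩ : ∃ j, r = i + j := Nat.exists_eq_add_of_le (by
    have := Finset.mem_range.1 hi1; omega)
  obtain ⟨k, rfl⟩ : ∃ k, i = k + 1 := Nat.exists_eq_add_of_le' (by omega)
  have hp (m : ℕ) : HasDerivAt (fun p : ℝ => p ^ m) (m * (1 / 2 : ℝ) ^ (m - 1)) (1 / 2) :=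
    hasDerivAt_pow m _
  have hq (m : ℕ) : HasDerivAt (fun p : ℝ => (1 - p) ^ m)
      (-(m * (1 / 2 : ℝ) ^ (m - 1))) (1 / 2) := by
    refine (((hasDerivAt_id' (1 / 2 : ℝ)).const_sub 1).fun_pow m).congr_deriv ?_
    norm_num
  have key := ((((hp (k + 1)).fun_mul (hq j)).const_mul (1 - a (k + 1))).fun_add
    (((hp j).fun_mul (hq (k + 1))).const_mul (a (k + 1)))).const_mul
      ((k + 1 + j).choose (k + 1) : ℝ)
  have hsub : k + 1 + j - (k + 1) = j := by omega
  rw [hsub]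
  refine key.congr_deriv ?_
  unfold coeff
  have h1 : k + 1 + j - 1 = k + j := by omega
  have h2 : (1 : ℝ) - 1 / 2 = 1 / 2 := by norm_num
  rw [h1, h2]
  rcases j with _ | l
  · simp
    field_simp
    ring
  · simp only [Nat.add_sub_cancel]
    push_cast
    simp only [one_div, inv_pow]
    field_simp
    ring

/-- The explicit form of the stability parameter:
`λ_r(a) = 2^{-(r-1)} ∑ (r choose i) (2i - r) (1 - 2 a_i)`. -/
theorem stabilityParameter_eq (r : ℕ) (a : ℕ → ℝ) :
    stabilityParameter r a = ∑ i ∈ majoritySizes r, coeff r i * (1 - 2 * a i) :=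
  (hasDerivAt_updateFunction r a).deriv

end LocalFlip

end

open scoped Topology

namespace LocalFlip

/-! By `stabilityParameter_eq`, the stability parameter is a sum of i.i.d. centred variables `1 - 2
* a i` with weights `coeff r i`. With `n = r - 1`, binomial identities give `scale r ^ 2 = (n + 1) *
centralBinom n / 4 ^ n` (`sum_coeff_sq`), and Wallis-type bounds place this between `√r / 2` and
`√r`. Claim 1 follows, and claim 3 too, the variance being `4 * Var a₁ * scale r ^ 2`. For claim 2,
the weights stay below `√8` (`coeff_sq_le`) while `scale r` diverges, so the normalised weights are
uniformly small. The characteristic function of one summand matches that of a Gaussian of equal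
variance up to `o(u ^ 2)`, and these errors add up to `o(1)` over the product. -/

/-! ### Exact value of `scale r ^ 2` -/

theorem sum_range_choose_mul_choose_succ (n : ℕ) :
    ∑ k ∈ Finset.range (n + 1), n.choose k * n.choose (k + 1) = (2 * n).choose (n + 1) := by
  rw [two_mul, Nat.add_choose_eq, Finset.Nat.sum_antidiagonal_eq_sum_range_succ_mk,
    Finset.sum_range_succ _ (n + 1), Nat.choose_succ_self, zero_mul, add_zero,
    ← Finset.sum_range_reflect]
  refine Finset.sum_congr rfl fun k hk => ?_
  have hk : k ≤ n := Nat.lt_succ_iff.1 (Finset.mem_range.1 hk)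
  have h1 : n + 1 - 1 - k = n - k := by omega
  have h2 : n + 1 - k = n - k + 1 := by omega
  rw [h1, h2, Nat.choose_symm hk]

/-- Absorption combined with Pascal's rule; turns the weights into differences of adjacent
binomials. -/
theorem choose_succ_mul_two_mul_sub (n k : ℕ) :
    ((n + 1).choose (k + 1) : ℝ) * (2 * ((k + 1 : ℕ) : ℝ) - ((n + 1 : ℕ) : ℝ)) =
      (n + 1) * (n.choose k - n.choose (k + 1)) := by
  have h : ((n + 1 : ℕ) : ℝ) * n.choose k = (n + 1).choose (k + 1) * ((k + 1 : ℕ) : ℝ) := by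
    exact_mod_cast Nat.add_one_mul_choose_eq n k
  have h' : ((n + 1).choose (k + 1) : ℝ) = n.choose k + n.choose (k + 1) := by
    exact_mod_cast Nat.choose_succ_succ n k
  push_cast at h ⊢
  rw [h'] at h ⊢
  linear_combination (-2) * h

theorem sum_range_choose_mul_two_mul_sub_sq (n : ℕ) :
    ∑ i ∈ Finset.range (n + 1 + 1),
      (((n + 1).choose i : ℝ) * (2 * (i : ℝ) - ((n + 1 : ℕ) : ℝ))) ^ 2 =
      2 * ((n : ℝ) + 1) * n.centralBinom := by
  rw [Finset.sum_range_succ']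
  simp only [choose_succ_mul_two_mul_sub]
  have h1 : ∑ k ∈ Finset.range (n + 1), (n.choose k : ℝ) ^ 2 = n.centralBinom := by
    exact_mod_cast Nat.sum_range_choose_sq n
  -- The missing `1` is compensated by the `i = 0` term split off above.
  have h2 : ∑ k ∈ Finset.range (n + 1), (n.choose (k + 1) : ℝ) ^ 2 = n.centralBinom - 1 := by
    have := Finset.sum_range_succ' (fun k => (n.choose k : ℝ) ^ 2) (n + 1)
    rw [Finset.sum_range_succ, h1] at this
    simp at this
    linarith
  have h3 : ∑ k ∈ Finset.range (n + 1), (n.choose k : ℝ) * n.choose (k + 1) =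
      (2 * n).choose (n + 1) := by
    exact_mod_cast sum_range_choose_mul_choose_succ n
  have h4 : ((2 * n).choose (n + 1) : ℝ) * (n + 1) = n.centralBinom * n := by
    have := Nat.choose_succ_right_eq (2 * n) n
    rw [show 2 * n - n = n by omega] at this
    exact_mod_cast this
  have h5 : ∑ k ∈ Finset.range (n + 1), (((n : ℝ) + 1) * (n.choose k - n.choose (k + 1))) ^ 2 =
      ((n : ℝ) + 1) ^ 2 * (∑ k ∈ Finset.range (n + 1), (n.choose k : ℝ) ^ 2 +
        ∑ k ∈ Finset.range (n + 1), (n.choose (k + 1) : ℝ) ^ 2 -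
        2 * ∑ k ∈ Finset.range (n + 1), (n.choose k : ℝ) * n.choose (k + 1)) := by
    rw [Finset.mul_sum _ _ (2 : ℝ), ← Finset.sum_add_distrib, ← Finset.sum_sub_distrib,
      Finset.mul_sum]
    exact Finset.sum_congr rfl fun k _ => by ring
  rw [h5, h1, h2, h3]
  push_cast
  simp only [Nat.choose_zero_right, Nat.cast_one]
  linear_combination (-2) * ((n : ℝ) + 1) * h4

theorem sum_range_eq_two_mul_sum_majoritySizes (r : ℕ) (f : ℕ → ℝ)
    (hf : ∀ i ≤ r, f (r - i) = f i) (h0 : ∀ i, 2 * i = r → f i = 0) :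
    ∑ i ∈ Finset.range (r + 1), f i = 2 * ∑ i ∈ majoritySizes r, f i := by
  rw [← Finset.sum_filter_add_sum_filter_not _ (fun i => r + 1 ≤ 2 * i), two_mul]
  congr 1
  symm
  -- Only nonzero terms are matched, which discards a possible midpoint `2 * i = r`.
  refine Finset.sum_bij_ne_zero (fun i _ _ => r - i) ?_ ?_ ?_ ?_
  · intro i hi _
    simp only [majoritySizes, Finset.mem_filter, Finset.mem_range] at hi ⊢
    omega
  · intro i hi _ j hj _ h
    simp only [majoritySizes, Finset.mem_filter, Finset.mem_range] at hi hj
    omega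
  · intro i hi hne
    simp only [Finset.mem_filter, Finset.mem_range] at hi
    have hi' : 2 * i ≠ r := fun h => hne (h0 i h)
    refine ⟨r - i, ?_, ?_, by omega⟩
    · simp only [majoritySizes, Finset.mem_filter, Finset.mem_range]
      omega
    · rwa [hf i (by omega)]
  · intro i hi _
    simp only [majoritySizes, Finset.mem_filter, Finset.mem_range] at hi
    exact (hf i (by omega)).symm

theorem sum_coeff_sq (n : ℕ) :
    ∑ i ∈ majoritySizes (n + 1), coeff (n + 1) i ^ 2 = (n + 1) * (n.centralBinom / 4 ^ n) := by
  have h := sum_range_choose_mul_two_mul_sub_sq n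
  rw [sum_range_eq_two_mul_sum_majoritySizes] at h
  · have h' : ∀ i, coeff (n + 1) i ^ 2 =
        (((n + 1).choose i : ℝ) * (2 * (i : ℝ) - ((n + 1 : ℕ) : ℝ))) ^ 2 / 4 ^ n := by
      intro i
      have : ((2 : ℝ) ^ n) ^ 2 = 4 ^ n := by rw [← pow_mul, mul_comm, pow_mul]; norm_num
      rw [coeff, Nat.add_sub_cancel, ← mul_div_assoc, div_pow, this]
    simp only [h', ← Finset.sum_div]
    rw [mul_assoc] at h
    rw [mul_left_cancel₀ two_ne_zero h, mul_div_assoc]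
  · intro i hi
    rw [Nat.choose_symm hi, Nat.cast_sub hi]
    ring
  · rintro i hi
    rw [← hi]
    push_cast
    ring

/-! ### Wallis-type bounds and the size of `scale r ^ 2` -/

theorem centralBinom_succ_div_four_pow (n : ℕ) :
    ((n + 1).centralBinom / 4 ^ (n + 1) : ℝ) =
      (n.centralBinom / 4 ^ n) * ((2 * n + 1) / (2 * (n + 1))) := by
  have h : ((n : ℝ) + 1) * (n + 1).centralBinom = 2 * (2 * n + 1) * n.centralBinom := by
    exact_mod_cast Nat.succ_mul_centralBinom_succ n
  have : (n : ℝ) + 1 ≠ 0 := by positivity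
  field_simp
  rw [pow_succ]
  linear_combination 2 * 4 ^ n * h

theorem centralBinom_div_four_pow_sq_mul_le_one (n : ℕ) :
    (n.centralBinom / 4 ^ n : ℝ) ^ 2 * (2 * n + 1) ≤ 1 := by
  induction n with
  | zero => simp
  | succ n ih =>
    rw [centralBinom_succ_div_four_pow]
    refine le_trans ?_ ih
    rw [mul_pow, mul_assoc]
    refine mul_le_mul_of_nonneg_left ?_ (by positivity)
    rw [div_pow, div_mul_eq_mul_div, div_le_iff₀ (by positivity)]
    push_cast
    have : (0 : ℝ) ≤ n := n.cast_nonneg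
    nlinarith

theorem one_le_centralBinom_div_four_pow_sq_mul (n : ℕ) :
    1 ≤ (n.centralBinom / 4 ^ n : ℝ) ^ 2 * (4 * (n + 1)) := by
  -- With the factor `4 * n` the product is nondecreasing and equals `1` at `n = 1`.
  suffices h : ∀ n : ℕ, 1 ≤ n → 1 ≤ (n.centralBinom / 4 ^ n : ℝ) ^ 2 * (4 * n) by
    rcases Nat.eq_zero_or_pos n with rfl | hn
    · norm_num
    · refine (h n hn).trans (mul_le_mul_of_nonneg_left ?_ (by positivity))
      linarith
  intro n hn
  induction n, hn using Nat.le_induction with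
  | base => norm_num [Nat.centralBinom, Nat.choose]
  | succ n hn ih =>
    rw [centralBinom_succ_div_four_pow]
    refine ih.trans ?_
    rw [mul_pow, mul_assoc]
    refine mul_le_mul_of_nonneg_left ?_ (by positivity)
    rw [div_pow, div_mul_eq_mul_div, le_div_iff₀ (by positivity)]
    push_cast
    have : (0 : ℝ) ≤ n := n.cast_nonneg
    nlinarith

theorem scale_sq (r : ℕ) : scale r ^ 2 = ∑ i ∈ majoritySizes r, coeff r i ^ 2 :=
  Real.sq_sqrt (Finset.sum_nonneg fun _ _ => sq_nonneg _)

theorem scale_sq_le (r : ℕ) : scale r ^ 2 ≤ √(r : ℝ) := by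
  rw [scale_sq]
  rcases r with _ | n
  · simp [majoritySizes, Finset.filter_singleton]
  · rw [sum_coeff_sq]
    refine Real.le_sqrt_of_sq_le ?_
    have := centralBinom_div_four_pow_sq_mul_le_one n
    set c : ℝ := n.centralBinom / 4 ^ n
    push_cast
    have h0 : (0 : ℝ) ≤ n := n.cast_nonneg
    have : c ^ 2 * (n + 1) ≤ 1 := by nlinarith [sq_nonneg c]
    nlinarith

theorem sqrt_div_two_le_scale_sq (r : ℕ) : √(r : ℝ) / 2 ≤ scale r ^ 2 := by
  rw [scale_sq]
  rcases r with _ | n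
  · simp [majoritySizes, Finset.filter_singleton]
  · rw [sum_coeff_sq]
    have := one_le_centralBinom_div_four_pow_sq_mul n
    have hc : (0 : ℝ) ≤ n.centralBinom / 4 ^ n := by positivity
    set c : ℝ := n.centralBinom / 4 ^ n
    have h0 : (0 : ℝ) ≤ n := n.cast_nonneg
    rw [div_le_iff₀ two_pos]
    refine Real.sqrt_le_iff.2 ⟨by positivity, ?_⟩
    push_cast
    nlinarith

/-! ### Uniform bound on the weights -/

theorem choose_div_two_pow_sq_mul_le_one (n i : ℕ) :
    (n.choose i / 2 ^ n : ℝ) ^ 2 * (n + 1) ≤ 1 := by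
  suffices h : (n.choose (n / 2) / 2 ^ n : ℝ) ^ 2 * (n + 1) ≤ 1 by
    refine le_trans ?_ h
    have : (n.choose i : ℝ) ≤ n.choose (n / 2) := by exact_mod_cast Nat.choose_le_middle i n
    gcongr
  obtain ⟨k, rfl | rfl⟩ := Nat.even_or_odd' n
  · have := centralBinom_div_four_pow_sq_mul_le_one k
    rw [Nat.mul_div_cancel_left k two_pos, pow_mul]
    norm_num
    exact this
  · have := centralBinom_div_four_pow_sq_mul_le_one (k + 1)
    rw [show (2 * k + 1) / 2 = k by omega]
    have hc : ((k + 1).centralBinom : ℝ) = 2 * (2 * k + 1).choose k := by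
      have h : (k + 1).centralBinom = (2 * k + 1).choose k + (2 * k + 1).choose (k + 1) :=
        Nat.choose_succ_succ (2 * k + 1) k
      rw [h, Nat.choose_symm_half]
      push_cast
      ring
    have hd : ((k + 1).centralBinom / 4 ^ (k + 1) : ℝ) =
        (2 * k + 1).choose k / 2 ^ (2 * k + 1) := by
      rw [hc, show (4 : ℝ) = 2 ^ 2 by norm_num, ← pow_mul, show 2 * (k + 1) = 2 * k + 1 + 1 by ring,
        pow_succ]
      field_simp
    rw [hd] at this
    push_cast at this ⊢
    nlinarith [sq_nonneg ((2 * k + 1).choose k / 2 ^ (2 * k + 1) : ℝ)]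

/-- Induction upwards from the middle. With `d = 2i - (n + 1)`, the right side grows by `4 (d + 2)`
times the new binomial; the left by at most `(d + 2)² - d² = 4d + 4` times it, since binomials
decrease past the middle. -/
theorem choose_mul_two_mul_sub_sq_le (n i : ℕ) (hi : n + 1 ≤ 2 * i) :
    ((n + 1).choose i : ℝ) * (2 * (i : ℝ) - ((n + 1 : ℕ) : ℝ)) ^ 2 ≤
      4 * (n + 1) * (n.choose (n / 2) - n.choose i) := by
  have hmid : ∀ k, (n.choose k : ℝ) ≤ n.choose (n / 2) := fun k => by
    exact_mod_cast Nat.choose_le_middle k n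
  have hn : (0 : ℝ) < n + 1 := by positivity
  have hbase : (n + 2) / 2 ≤ i := by omega
  clear hi
  induction i, hbase using Nat.le_induction with
  | base =>
    obtain ⟨k, rfl | rfl⟩ := Nat.even_or_odd' n
    · have h := choose_succ_mul_two_mul_sub (2 * k) k
      rw [show (2 * k + 2) / 2 = k + 1 by omega]
      have e : 2 * ((k + 1 : ℕ) : ℝ) - ((2 * k + 1 : ℕ) : ℝ) = 1 := by push_cast; ring
      rw [e] at h ⊢
      rw [one_pow, h, mul_assoc 4]
      have h1 := mul_le_mul_of_nonneg_left (hmid k) hn.le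
      have h2 := mul_le_mul_of_nonneg_left (hmid (k + 1)) hn.le
      push_cast at *
      linarith
    · rw [show (2 * k + 1 + 2) / 2 = k + 1 by omega]
      have e : 2 * ((k + 1 : ℕ) : ℝ) - ((2 * k + 1 + 1 : ℕ) : ℝ) = 0 := by push_cast; ring
      rw [e]
      have := mul_nonneg hn.le (sub_nonneg.2 (hmid (k + 1)))
      push_cast at *
      linarith
  | succ i hi ih =>
    have h := choose_succ_mul_two_mul_sub n i
    have hanti : ((n + 1).choose (i + 1) : ℝ) ≤ (n + 1).choose i := by
      have h1 := Nat.choose_succ_right_eq (n + 1) i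
      have h2 : n + 1 - i ≤ i + 1 := by omega
      have h3 := h1.trans_le (Nat.mul_le_mul_left ((n + 1).choose i) h2)
      exact_mod_cast Nat.le_of_mul_le_mul_right h3 (Nat.succ_pos i)
    have hd := mul_le_mul_of_nonneg_right hanti
      (sq_nonneg (2 * (i : ℝ) - ((n + 1 : ℕ) : ℝ)))
    have hpos : (0 : ℝ) ≤ (n + 1).choose (i + 1) := Nat.cast_nonneg _
    push_cast at *
    nlinarith

theorem coeff_sq_le (r i : ℕ) (hi : i ∈ majoritySizes r) : coeff r i ^ 2 ≤ 8 := by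
  simp only [majoritySizes, Finset.mem_filter, Finset.mem_range] at hi
  obtain ⟨n, rfl⟩ : ∃ n, r = n + 1 := Nat.exists_eq_add_of_le' (by omega)
  have h1 := choose_mul_two_mul_sub_sq_le n i (by omega)
  have h2 := choose_div_two_pow_sq_mul_le_one n (n / 2)
  have h3 := choose_div_two_pow_sq_mul_le_one (n + 1) i
  rw [coeff, Nat.add_sub_cancel]
  set d : ℝ := 2 * (i : ℝ) - ((n + 1 : ℕ) : ℝ)
  set x : ℝ := ((n + 1).choose i : ℝ) / 2 ^ (n + 1) with hx
  set y : ℝ := (n.choose (n / 2) : ℝ) / 2 ^ n with hy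
  have hx0 : 0 ≤ x := by positivity
  have hy0 : 0 ≤ y := by positivity
  have e1 : ((n + 1).choose i : ℝ) = x * (2 * 2 ^ n) := by
    rw [hx, pow_succ]; field_simp
  have e2 : (n.choose (n / 2) : ℝ) = y * 2 ^ n := by
    rw [hy]; field_simp
  have hp : (0 : ℝ) < 2 ^ n := by positivity
  have h4 : x * d ^ 2 ≤ 2 * (n + 1) * y := by
    have : x * (2 * 2 ^ n) * d ^ 2 ≤ 4 * (n + 1) * (y * 2 ^ n) := by
      rw [← e1, ← e2]
      refine h1.trans (mul_le_mul_of_nonneg_left ?_ (by positivity))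
      linarith [(Nat.cast_nonneg (n.choose i) : (0 : ℝ) ≤ _)]
    refine le_of_mul_le_mul_right ?_ hp
    linarith
  -- Bounding only `x * d ^ 2` by `h4` leaves `8 * (n + 1) * x * y`, and `x`, `y` are both at most
  -- `1 / √(n + 1)`.
  have e3 : (((n + 1).choose i : ℝ) * (d / 2 ^ n)) ^ 2 = 4 * (x * (x * d ^ 2)) := by
    rw [e1]; field_simp; ring
  rw [e3]
  have h5 : x * (x * d ^ 2) ≤ x * (2 * (n + 1) * y) := mul_le_mul_of_nonneg_left h4 hx0
  have h6 : x ^ 2 * (n + 1) ≤ 1 := by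
    push_cast at h3
    nlinarith [sq_nonneg x]
  have h7 : (n + 1) * (x * y) ≤ 1 := by
    nlinarith [mul_nonneg (by positivity : (0 : ℝ) ≤ n + 1) (sq_nonneg (x - y))]
  nlinarith

/-! ### Weighted central limit theorem -/

theorem norm_prod_sub_prod_le {ι : Type*} (s : Finset ι) (f g : ι → ℂ)
    (hf : ∀ i, ‖f i‖ ≤ 1) (hg : ∀ i, ‖g i‖ ≤ 1) :
    ‖∏ i ∈ s, f i - ∏ i ∈ s, g i‖ ≤ ∑ i ∈ s, ‖f i - g i‖ := by
  classical
  induction s using Finset.induction_on with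
  | empty => simp
  | insert j s hj ih =>
    rw [Finset.prod_insert hj, Finset.prod_insert hj, Finset.sum_insert hj]
    have hgs : ‖∏ i ∈ s, g i‖ ≤ 1 := by
      rw [norm_prod]
      exact Finset.prod_le_one (fun _ _ => norm_nonneg _) fun i _ => hg i
    calc ‖f j * ∏ i ∈ s, f i - g j * ∏ i ∈ s, g i‖
        = ‖(f j - g j) * ∏ i ∈ s, g i + f j * (∏ i ∈ s, f i - ∏ i ∈ s, g i)‖ := by
          congr 1; ring
      _ ≤ ‖f j - g j‖ * ‖∏ i ∈ s, g i‖ + ‖f j‖ * ‖∏ i ∈ s, f i - ∏ i ∈ s, g i‖ := by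
          refine (norm_add_le _ _).trans ?_
          rw [norm_mul, norm_mul]
      _ ≤ ‖f j - g j‖ * 1 + 1 * ∑ i ∈ s, ‖f i - g i‖ := by
          gcongr
          exact hf j
      _ = _ := by ring

theorem tendsto_prod_sub_prod_of_isLittleO {ι : Type*} {φ ψ : ℝ → ℂ}
    (hφ : ∀ u, ‖φ u‖ ≤ 1) (hψ : ∀ u, ‖ψ u‖ ≤ 1)
    (h : (fun u => φ u - ψ u) =o[𝓝 0] fun u => u ^ 2)
    (s : ℕ → Finset ι) (c : ℕ → ι → ℝ) (M : ℕ → ℝ)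
    (hM : Tendsto M atTop (𝓝 0)) (hc : ∀ n, ∀ i ∈ s n, |c n i| ≤ M n)
    (C : ℝ) (hC : ∀ n, ∑ i ∈ s n, c n i ^ 2 ≤ C) :
    Tendsto (fun n => ∏ i ∈ s n, φ (c n i) - ∏ i ∈ s n, ψ (c n i)) atTop (𝓝 0) := by
  have hC0 : 0 ≤ C := (Finset.sum_nonneg fun _ _ => sq_nonneg _).trans (hC 0)
  rw [Metric.tendsto_nhds]
  intro ε hε
  have hδ : 0 < ε / (C + 1) := by positivity
  obtain ⟨δ, hδ0, hball⟩ := Metric.eventually_nhds_iff.1 (h.def hδ)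
  filter_upwards [hM.eventually (gt_mem_nhds hδ0)] with n hn
  rw [dist_zero_right]
  calc ‖∏ i ∈ s n, φ (c n i) - ∏ i ∈ s n, ψ (c n i)‖
      ≤ ∑ i ∈ s n, ‖φ (c n i) - ψ (c n i)‖ :=
        norm_prod_sub_prod_le _ _ _ (fun _ => hφ _) fun _ => hψ _
    _ ≤ ∑ i ∈ s n, ε / (C + 1) * c n i ^ 2 := by
        refine Finset.sum_le_sum fun i hi => ?_
        have := @hball (c n i) (by simpa using (hc n i hi).trans_lt hn)
        simpa using this
    _ ≤ ε / (C + 1) * C := by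
        rw [← Finset.mul_sum]
        exact mul_le_mul_of_nonneg_left (hC n) hδ.le
    _ < ε := by
        rw [div_mul_eq_mul_div, div_lt_iff₀ (by positivity)]
        nlinarith

/-- The second-order Taylor polynomial at `0` depends only on the first two moments. -/
theorem charFun_sub_charFun_isLittleO (μ ν : Measure ℝ) [IsProbabilityMeasure μ]
    [IsProbabilityMeasure ν] (hμ : MemLp id 2 μ) (hν : MemLp id 2 ν)
    (h1 : ∫ x, x ∂μ = ∫ x, x ∂ν) (h2 : ∫ x, x ^ 2 ∂μ = ∫ x, x ^ 2 ∂ν) :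
    (fun t => charFun μ t - charFun ν t) =o[𝓝 0] fun t : ℝ => t ^ 2 := by
  have key : ∀ (ρ : Measure ℝ) [IsProbabilityMeasure ρ], MemLp id 2 ρ →
      (fun t => charFun ρ t -
        ∑ k ∈ Finset.range 3, (k.factorial : ℂ)⁻¹ * (t * Complex.I) ^ k * ∫ x, x ^ k ∂ρ)
        =o[𝓝 0] fun t : ℝ => t ^ 2 := by
    intro ρ _ hρ
    have hρ' : MemLp id ((2 : ℕ) : ENNReal) ρ := by exact_mod_cast hρ
    have h := taylor_isLittleO_univ (f := charFun ρ) (x₀ := 0) (n := 2) (contDiff_charFun hρ')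
    simp only [taylorWithinEval_charFun_zero hρ', sub_zero] at h
    exact h
  refine ((key μ hμ).sub (key ν hν)).congr_left fun t => ?_
  simp [Finset.sum_range_succ, h1, h2]

/-- A central limit theorem for weighted sums of independent, identically distributed random
variables whose weights are uniformly small and whose squares sum to one. -/
theorem tendstoInDistribution_weighted_sum {Ω : Type*} [MeasurableSpace Ω] (μ : Measure Ω)
    [IsProbabilityMeasure μ] {X : ℕ → Ω → ℝ} {Y : Ω → ℝ} (hindep : iIndepFun X μ)
    (hident : ∀ i, IdentDistrib (X i) Y μ μ) (hY : MemLp Y 2 μ) (hmean : ∫ ω, Y ω ∂μ = 0)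
    (s : ℕ → Finset ℕ) (c : ℕ → ℕ → ℝ) (M : ℕ → ℝ)
    (hM : Tendsto M atTop (𝓝 0)) (hc : ∀ n, ∀ i ∈ s n, |c n i| ≤ M n)
    (hle : ∀ n, ∑ i ∈ s n, c n i ^ 2 ≤ 1) (hone : ∀ᶠ n in atTop, ∑ i ∈ s n, c n i ^ 2 = 1) :
    TendstoInDistribution (fun n ω => ∑ i ∈ s n, c n i * X i ω) atTop (fun x : ℝ => x)
      (fun _ => μ) (gaussianReal 0 (variance Y μ).toNNReal) := by
  have mX : ∀ i, AEMeasurable (X i) μ := fun i => (hident i).aemeasurable_fst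
  have mY : AEMeasurable Y μ := (hident 0).aemeasurable_snd
  have msum : ∀ n, AEMeasurable (fun ω => ∑ i ∈ s n, c n i * X i ω) μ := fun n =>
    Finset.aemeasurable_fun_sum _ fun i _ => (mX i).const_mul _
  have : IsProbabilityMeasure (μ.map Y) := Measure.isProbabilityMeasure_map mY
  set v := (variance Y μ).toNNReal with hv
  refine ⟨msum, aemeasurable_id', ?_⟩
  refine ProbabilityMeasure.tendsto_iff_tendsto_charFun.2 fun t => ?_
  have hcf : ∀ n, charFun (μ.map fun ω => ∑ i ∈ s n, c n i * X i ω) t =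
      ∏ i ∈ s n, charFun (μ.map Y) (c n i * t) := by
    intro n
    have hi : iIndepFun (fun i ω => c n i * X i ω) μ :=
      hindep.comp (fun i x => c n i * x) fun i => measurable_const_mul _
    rw [(hi.restrict _).charFun_map_fun_finsetSum_eq_prod fun i _ => (mX i).const_mul _,
      Finset.prod_apply]
    refine Finset.prod_congr rfl fun i _ => ?_
    rw [charFun_map_mul_comp (mX i), (hident i).map_eq]
  have hlaw : (fun u => charFun (μ.map Y) u - charFun (gaussianReal 0 v) u)
      =o[𝓝 0] fun u : ℝ => u ^ 2 := by
    refine charFun_sub_charFun_isLittleO _ _ ?_ ?_ ?_ ?_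
    · exact (memLp_map_measure_iff aestronglyMeasurable_id mY).2 hY
    · exact memLp_id_gaussianReal 2
    · rw [integral_map mY (by fun_prop), integral_id_gaussianReal]
      exact hmean
    · have h1 : ∫ x, x ^ 2 ∂(μ.map Y) = variance Y μ := by
        rw [integral_map mY (by fun_prop), variance_of_integral_eq_zero mY hmean]
      have h2 : ∫ x, x ^ 2 ∂(gaussianReal 0 v) = v := by
        rw [← variance_of_integral_eq_zero (X := fun x : ℝ => x) aemeasurable_id'
          integral_id_gaussianReal]
        exact variance_fun_id_gaussianReal
      rw [h1, h2, hv, Real.coe_toNNReal _ (variance_nonneg _ _)]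
  have hdiff := tendsto_prod_sub_prod_of_isLittleO (fun u => norm_charFun_le_one u)
    (fun u => norm_charFun_le_one u) hlaw s (fun n i => c n i * t) (fun n => M n * |t|)
    (by simpa using hM.mul_const |t|)
    (fun n i hi => by
      rw [abs_mul]; exact mul_le_mul_of_nonneg_right (hc n i hi) (abs_nonneg t))
    (t ^ 2) (fun n => by
      simp only [mul_pow, ← Finset.sum_mul]
      exact mul_le_of_le_one_left (sq_nonneg t) (hle n))
  -- Gaussian stability: the exponents are quadratic and the squared weights sum to one.
  have hgauss : ∀ᶠ n in atTop, ∏ i ∈ s n, charFun (gaussianReal 0 v) (c n i * t) =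
      charFun (gaussianReal 0 v) t := by
    filter_upwards [hone] with n hn
    simp only [charFun_gaussianReal]
    rw [← Complex.exp_sum]
    congr 1
    have hn' : ∑ i ∈ s n, (c n i : ℂ) ^ 2 = 1 := by exact_mod_cast hn
    have e : ∀ i, (((c n i * t : ℝ) : ℂ) * ((0 : ℝ) : ℂ) * Complex.I -
        v * ((c n i * t : ℝ) : ℂ) ^ 2 / 2) = (c n i : ℂ) ^ 2 * (-(v * t ^ 2 / 2)) := by
      intro i; push_cast; ring
    simp only [e, ← Finset.sum_mul, hn']
    push_cast; ring
  have hlim := hdiff.add (tendsto_const_nhds (x := charFun (gaussianReal 0 v) t))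
  rw [zero_add] at hlim
  simp only [ProbabilityMeasure.coe_mk, Measure.map_id']
  refine hlim.congr' ?_
  filter_upwards [hgauss] with n hn
  rw [hcf, hn, sub_add_cancel]

/-! ### Asymptotics of the scale and of the stability parameter -/

theorem scale_nonneg (r : ℕ) : 0 ≤ scale r := Real.sqrt_nonneg _

theorem scale_pos {r : ℕ} (hr : 1 ≤ r) : 0 < scale r := by
  have h : 0 < √(r : ℝ) := Real.sqrt_pos.2 (by exact_mod_cast hr)
  have := sqrt_div_two_le_scale_sq r
  exact (scale_nonneg r).lt_of_ne' fun h0 => by rw [h0] at this; norm_num at this; linarith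

theorem scale_sq_isTheta : (fun r : ℕ => scale r ^ 2) =Θ[atTop] fun r : ℕ => √(r : ℝ) := by
  constructor
  · refine IsBigO.of_bound 1 (Eventually.of_forall fun r => ?_)
    rw [Real.norm_of_nonneg (sq_nonneg _), Real.norm_of_nonneg (Real.sqrt_nonneg _), one_mul]
    exact scale_sq_le r
  · refine IsBigO.of_bound 2 (Eventually.of_forall fun r => ?_)
    rw [Real.norm_of_nonneg (sq_nonneg _), Real.norm_of_nonneg (Real.sqrt_nonneg _)]
    linarith [sqrt_div_two_le_scale_sq r]

theorem rpow_one_div_four_sq (r : ℕ) : ((r : ℝ) ^ (1 / 4 : ℝ)) ^ 2 = √(r : ℝ) := by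
  rw [← Real.rpow_natCast, ← Real.rpow_mul r.cast_nonneg, Real.sqrt_eq_rpow]
  norm_num

theorem scale_isTheta :
    (fun r : ℕ => scale r) =Θ[atTop] fun r : ℕ => (r : ℝ) ^ (1 / 4 : ℝ) := by
  have h := scale_sq_isTheta
  simp only [← rpow_one_div_four_sq] at h
  exact ⟨IsBigO.of_pow two_ne_zero h.1, IsBigO.of_pow two_ne_zero h.2⟩

theorem tendsto_scale_atTop : Tendsto scale atTop atTop := by
  have h : Tendsto (fun r : ℕ => √(r : ℝ) / 2) atTop atTop :=
    (Real.tendsto_sqrt_atTop.comp tendsto_natCast_atTop_atTop).atTop_div_const two_pos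
  have h' := Real.tendsto_sqrt_atTop.comp (tendsto_atTop_mono sqrt_div_two_le_scale_sq h)
  refine h'.congr fun r => ?_
  exact Real.sqrt_sq (scale_nonneg r)

theorem variance_one_sub_two_mul {Ω : Type*} [MeasurableSpace Ω] {μ : Measure Ω}
    [IsProbabilityMeasure μ] {a : Ω → ℝ} (ha : AEMeasurable a μ) :
    variance (fun ω => 1 - 2 * a ω) μ = 4 * variance a μ := by
  rw [variance_const_sub (ha.const_mul 2).aestronglyMeasurable, variance_const_mul]
  norm_num

theorem variance_stabilityParameter {Ω : Type*} [MeasurableSpace Ω] {μ : Measure Ω}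
    [IsProbabilityMeasure μ] {a : ℕ → Ω → ℝ} (h_indep : iIndepFun a μ)
    (h_ident : ∀ i, IdentDistrib (a i) (a 1) μ μ) (h_mem : ∀ i, MemLp (a i) 2 μ) (r : ℕ) :
    variance (fun ω => stabilityParameter r fun i => a i ω) μ =
      4 * variance (a 1) μ * scale r ^ 2 := by
  simp only [stabilityParameter_eq]
  have hindep : iIndepFun (fun i ω => coeff r i * (1 - 2 * a i ω)) μ :=
    h_indep.comp (fun i x => coeff r i * (1 - 2 * x)) fun i => by fun_prop
  have hmem : ∀ i, MemLp (fun ω => coeff r i * (1 - 2 * a i ω)) 2 μ := fun i =>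
    ((memLp_const 1).sub ((h_mem i).const_mul 2)).const_mul _
  have hvar := IndepFun.variance_sum (s := majoritySizes r) (fun i _ => hmem i)
    fun i _ j _ hij => hindep.indepFun hij
  rw [Finset.sum_fn] at hvar
  rw [hvar, scale_sq, Finset.mul_sum]
  refine Finset.sum_congr rfl fun i _ => ?_
  rw [variance_const_mul, variance_one_sub_two_mul (h_ident i).aemeasurable_fst,
    (h_ident i).variance_eq, mul_comm]

theorem tendstoInDistribution_stabilityParameter_div_scale {Ω : Type*} [MeasurableSpace Ω]
    {μ : Measure Ω} [IsProbabilityMeasure μ] {a : ℕ → Ω → ℝ} (h_indep : iIndepFun a μ)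
    (h_ident : ∀ i, IdentDistrib (a i) (a 1) μ μ) (h_mem : ∀ i, MemLp (a i) 2 μ)
    (h_mean : ∫ ω, a 1 ω ∂μ = 1 / 2) :
    TendstoInDistribution
      (fun (r : ℕ) (ω : Ω) => stabilityParameter r (fun i => a i ω) / scale r)
      atTop (fun x : ℝ => x) (fun _ : ℕ => μ)
      (gaussianReal 0 (4 * variance (a 1) μ).toNNReal) := by
  have hu : Measurable fun x : ℝ => 1 - 2 * x := by fun_prop
  have hmean : ∫ ω, (1 - 2 * a 1 ω) ∂μ = 0 := by
    rw [integral_sub (integrable_const _) (((h_mem 1).integrable one_le_two).const_mul 2),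
      integral_const_mul, h_mean]
    simp
  have hsum : ∀ r, ∑ i ∈ majoritySizes r, (coeff r i / scale r) ^ 2 =
      scale r ^ 2 / scale r ^ 2 := fun r => by
    simp only [div_pow, ← Finset.sum_div, scale_sq]
  have h := tendstoInDistribution_weighted_sum μ (X := fun i ω => 1 - 2 * a i ω)
    (Y := fun ω => 1 - 2 * a 1 ω) (h_indep.comp (fun _ x => 1 - 2 * x) fun _ => hu)
    (fun i => (h_ident i).comp hu) ((memLp_const 1).sub ((h_mem 1).const_mul 2)) hmean
    majoritySizes (fun r i => coeff r i / scale r) (fun r => √8 / scale r)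
    (tendsto_scale_atTop.const_div_atTop _)
    (fun r i hi => by
      rw [abs_div, abs_of_nonneg (scale_nonneg r)]
      exact div_le_div_of_nonneg_right (Real.abs_le_sqrt (coeff_sq_le r i hi)) (scale_nonneg r))
    -- At `r = 0` the quotient is `0 / 0 = 0`, so equality with `1` holds only from `r = 1` on.
    (fun r => (hsum r).trans_le (div_self_le_one _))
    (by
      filter_upwards [eventually_ge_atTop 1] with r hr
      rw [hsum, div_self (pow_ne_zero 2 (scale_pos hr).ne')])
  rw [variance_one_sub_two_mul (h_ident 1).aemeasurable_fst] at h
  convert! h using 3 with r ω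
  rw [stabilityParameter_eq, Finset.sum_div]
  exact Finset.sum_congr rfl fun i _ => by ring

end LocalFlip

theorem theorem2 {Ω : Type*} [MeasurableSpace Ω] (μ : Measure Ω) [IsProbabilityMeasure μ]
    (a : ℕ → Ω → ℝ)
    (h_indep : iIndepFun a μ)
    (h_ident : ∀ i, IdentDistrib (a i) (a 1) μ μ)
    (h_supp : ∀ i, ∀ᵐ ω ∂μ, a i ω ∈ Set.Icc (0 : ℝ) 1)
    (h_mean : ∀ i, ∫ ω, a i ω ∂μ = 1 / 2)
    (h_var : 0 < variance (a 1) μ) :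
    (fun r : ℕ => LocalFlip.scale r) =Θ[atTop] (fun r : ℕ => (r : ℝ) ^ (1 / 4 : ℝ)) ∧
    TendstoInDistribution
      (fun (r : ℕ) (ω : Ω) =>
        LocalFlip.stabilityParameter r (fun i => a i ω) / LocalFlip.scale r)
      atTop (fun x : ℝ => x) (fun _ : ℕ => μ)
      (gaussianReal 0 (4 * variance (a 1) μ).toNNReal) ∧
    (fun r : ℕ => variance (fun ω => LocalFlip.stabilityParameter r (fun i => a i ω)) μ)
      =Θ[atTop] (fun r : ℕ => √(r : ℝ)) := by
  have h_mem : ∀ i, MemLp (a i) 2 μ := fun i =>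
    memLp_of_bounded (h_supp i) (h_ident i).aemeasurable_fst.aestronglyMeasurable 2
  refine ⟨LocalFlip.scale_isTheta,
    LocalFlip.tendstoInDistribution_stabilityParameter_div_scale h_indep h_ident h_mem (h_mean 1),
    ?_⟩
  simp only [LocalFlip.variance_stabilityParameter h_indep h_ident h_mem]
  exact (isTheta_const_mul_left (by positivity)).2 LocalFlip.scale_sq_isTheta
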